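/- Let $X$ be a smooth Riemannian manifold with Levi-Civita connection $\nabla$, and let $\varphi$ be a calibration of degree $p\ge 1$ on $X$, i.e. a smooth closed $p$-form with $\varphi(\xi)\le 1$ for every unit simple tangent $p$-vector $\xi$. The unit simple $p$-vectors $\xi$ with $\varphi(\xi)=1$ are called $\varphi$-planes. A $\varphi$-submanifold is an oriented smooth submanifold $M\subset X$ of dimension $p$ whose oriented unit tangent $p$-vector $\overrightarrow{T}_xM$ is a $\varphi$-plane for every $x\in M$. The calibration $\varphi$ is integrable if for every $x\in X$ and every $\varphi$-plane $\xi$ at $x$ there is a $\varphi$-submanifold $M$ through $x$ with $\overrightarrow{T}_xM=\xi$. For $f\in C^\infty(X)$ put $d^\varphi f=\nabla f\,\lrcorner\,\varphi$; the function $f$ is $\varphi$-plurisubharmonic if $$\bigl(dd^\varphi f-\nabla_{\nabla f}\varphi\bigr)(\xi)\ \ge\ 0\qquad\text{for all }\varphi\text{-planes }\xi .$$ Theorem 1.4. Let $f\in C^\infty(X)$. 1. If $f$ is $\varphi$-plurisubharmonic, then for every $\varphi$-submanifold $M\subset X$ the restriction $f|_M$ is subharmonic for the induced metric, i.e. $\Delta_M(f|_M)\ge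 0$ on $M$, where $\Delta_M=\operatorname{tr}\operatorname{Hess}$ is the Laplace–Beltrami operator of the induced metric. 2. Conversely, suppose that $\varphi$ is integrable. If $f|_M$ is subharmonic for the induced metric on every $\varphi$-submanifold $M\subset X$, then $f$ is $\varphi$-plurisubharmonic. -/

import Mathlib

open scoped ContDiff Manifold Topology

noncomputable section

namespace Calibrated

/-! ### Riemannian calculus on an open subset of a finite-dimensional vector space

`G : V → V →L[ℝ] V →L[ℝ] ℝ` is a field of inner products on (an open subset of) `V`, that is, the
matrix `g_ij` of a Riemannian metric in a coordinate chart with values in `V`. -/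

section Coordinates

variable {V : Type*} [NormedAddCommGroup V] [NormedSpace ℝ V]

/-- The Christoffel symbols `Γ(v, w) = ∇_v w` (for constant coordinate fields `v`, `w`) of the
Levi-Civita connection of `G`, determined by the Koszul formula
`2 G(Γ(v, w), z) = (D_v G)(w, z) + (D_w G)(v, z) - (D_z G)(v, w)`.
Here `(G y).inverse` turns a covector into the vector that represents it. -/
def christoffel (G : V → V →L[ℝ] V →L[ℝ] ℝ) (y v : V) : V →L[ℝ] V :=
  (G y).inverse.comp ((1 / 2 : ℝ) • (fderiv ℝ G y v + (fderiv ℝ G y).flip v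
    - ((fderiv ℝ G y).flip v).flip))

/-- The Koszul formula, for an invertible (that is, nondegenerate) `G y`. -/
theorem christoffel_spec (G : V → V →L[ℝ] V →L[ℝ] ℝ) (y : V) (hG : (G y).IsInvertible)
    (v w z : V) :
    2 * G y (christoffel G y v w) z
      = fderiv ℝ G y v w z + fderiv ℝ G y w v z - fderiv ℝ G y z v w := by
  simp [christoffel, hG.self_apply_inverse]

theorem christoffel_add (G : V → V →L[ℝ] V →L[ℝ] ℝ) (y v v' : V) :
    christoffel G y (v + v') = christoffel G y v + christoffel G y v' := by
  unfold christoffel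
  rw [← ContinuousLinearMap.comp_add]
  congr 1
  ext w z
  simp
  ring

theorem christoffel_smul (G : V → V →L[ℝ] V →L[ℝ] ℝ) (c : ℝ) (y v : V) :
    christoffel G y (c • v) = c • christoffel G y v := by
  unfold christoffel
  rw [← ContinuousLinearMap.comp_smul]
  congr 1
  ext w z
  simp
  ring

/-- The Riemannian Hessian `Hess F (v, w) = v (w F) - (∇_v w) F` of a function `F`
(for constant coordinate fields `v`, `w`), as a covector in `w`. -/
def coordHessian (G : V → V →L[ℝ] V →L[ℝ] ℝ) (F : V → ℝ) (y v : V) : V →L[ℝ] ℝ :=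
  fderiv ℝ (fderiv ℝ F) y v - (fderiv ℝ F y).comp (christoffel G y v)

/-- The Hessian as the endomorphism `v ↦ ∇_v (∇ F)` of the tangent space. -/
def coordHessianEnd (G : V → V →L[ℝ] V →L[ℝ] ℝ) (F : V → ℝ) (y : V) : V →ₗ[ℝ] V where
  toFun v := (G y).inverse (coordHessian G F y v)
  map_add' v v' := by
    rw [← map_add]
    congr 1
    simp only [coordHessian, christoffel_add, map_add, ContinuousLinearMap.comp_add]
    abel
  map_smul' c v := by
    rw [RingHom.id_apply, ← map_smul]
    congr 1
    simp only [coordHessian, christoffel_smul, map_smul, ContinuousLinearMap.comp_smul, smul_sub]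

/-- The Laplace-Beltrami operator `Δ F = tr (Hess F) = g^ij (∂_i ∂_j F - Γ_ij^k ∂_k F)`. -/
def coordLaplacian (G : V → V →L[ℝ] V →L[ℝ] ℝ) (F : V → ℝ) (y : V) : ℝ :=
  LinearMap.trace ℝ V (coordHessianEnd G F y)

/-- The covariant derivative `(∇_v η)(w₁, …, w_k)
= (D_v η)(w₁, …, w_k) - ∑ i, η(w₁, …, Γ(v, w_i), …, w_k)` of a `k`-form `η` in the direction `v`. -/
def coordCovDeriv {k : ℕ} (G : V → V →L[ℝ] V →L[ℝ] ℝ) (η : V → V [⋀^Fin k]→L[ℝ] ℝ)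
    (y v : V) (w : Fin k → V) : ℝ :=
  fderiv ℝ η y v w - ∑ i, η y (Function.update w i (christoffel G y v (w i)))

/-- The contraction `v ⌟ η = η(v, ·, …, ·)`. -/
def contract {k : ℕ} (v : V) (η : V [⋀^Fin (k + 1)]→L[ℝ] ℝ) : V [⋀^Fin k]→L[ℝ] ℝ :=
  η.curryLeft v

theorem contract_apply {k : ℕ} (v : V) (η : V [⋀^Fin (k + 1)]→L[ℝ] ℝ) (w : Fin k → V) :
    contract v η w = η (Matrix.vecCons v w) := rfl

end Coordinates

/-! ### Metrics, forms and functions on a manifold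

`Y` is a manifold without boundary modelled on the vector space `V`. Metrics and forms are written
in the preferred chart at a point through the derivative of the inverse of that chart. -/

section Manifold

variable {V : Type*} [NormedAddCommGroup V] [NormedSpace ℝ V]
  {Y : Type*} [TopologicalSpace Y] [ChartedSpace V Y]

/-- A field of bilinear forms on the tangent spaces of `Y`. -/
abbrev BilinField (V : Type*) [NormedAddCommGroup V] [NormedSpace ℝ V]
    (Y : Type*) [TopologicalSpace Y] [ChartedSpace V Y] : Type _ :=
  ∀ y : Y, TangentSpace 𝓘(ℝ, V) y →L[ℝ] TangentSpace 𝓘(ℝ, V) y →L[ℝ] ℝ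

/-- A (not necessarily continuous) differential `k`-form on `Y`. -/
abbrev FormField (V : Type*) [NormedAddCommGroup V] [NormedSpace ℝ V]
    (Y : Type*) [TopologicalSpace Y] [ChartedSpace V Y] (k : ℕ) : Type _ :=
  ∀ y : Y, (TangentSpace 𝓘(ℝ, V) y) [⋀^Fin k]→L[ℝ] ℝ

/-- The derivative at `z` of the inverse of the preferred chart at `y₀`. -/
def chartFrame (y₀ : Y) (z : V) :
    V →L[ℝ] TangentSpace 𝓘(ℝ, V) ((extChartAt 𝓘(ℝ, V) y₀).symm z) :=
  mfderiv 𝓘(ℝ, V) 𝓘(ℝ, V) (extChartAt 𝓘(ℝ, V) y₀).symm z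

/-- The derivative at `y` of the preferred chart at `y`. -/
def chartDeriv (y : Y) : TangentSpace 𝓘(ℝ, V) y →L[ℝ] V :=
  mfderiv 𝓘(ℝ, V) 𝓘(ℝ, V) (extChartAt 𝓘(ℝ, V) y) y

/-- The metric `g` in the chart at `y₀`. -/
def metricInChart (g : BilinField V Y) (y₀ : Y) (z : V) : V →L[ℝ] V →L[ℝ] ℝ :=
  ContinuousLinearMap.bilinearComp (E := V) (F := V) (g ((extChartAt 𝓘(ℝ, V) y₀).symm z))
    (chartFrame y₀ z) (chartFrame y₀ z)

theorem metricInChart_apply (g : BilinField V Y) (y₀ : Y) (z v w : V) :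
    metricInChart g y₀ z v w
      = g ((extChartAt 𝓘(ℝ, V) y₀).symm z) (chartFrame y₀ z v) (chartFrame y₀ z w) := rfl

/-- The form `η` in the chart at `y₀`. -/
def formInChart {k : ℕ} (η : FormField V Y k) (y₀ : Y) (z : V) : V [⋀^Fin k]→L[ℝ] ℝ :=
  (η ((extChartAt 𝓘(ℝ, V) y₀).symm z)).compContinuousLinearMap (chartFrame y₀ z)

/-- The form `η` is smooth (in all charts of the atlas). -/
def IsSmoothForm {k : ℕ} (η : FormField V Y k) : Prop :=
  ∀ y₀ : Y, ContDiffOn ℝ ∞ (formInChart η y₀) (extChartAt 𝓘(ℝ, V) y₀).target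

/-- The exterior derivative `dη`. -/
def extDerivForm {k : ℕ} (η : FormField V Y k) : FormField V Y (k + 1) := fun y ↦
  (extDeriv (formInChart η y) (extChartAt 𝓘(ℝ, V) y y)).compContinuousLinearMap (chartDeriv y)

/-- The covariant derivative `(∇_v η)(w₁, …, w_k)`, at the point `y`, of the form `η` in the
direction `v` for the Levi-Civita connection of `g`. -/
def covDerivForm {k : ℕ} (g : BilinField V Y) (η : FormField V Y k) (y : Y)
    (v : TangentSpace 𝓘(ℝ, V) y) (w : Fin k → TangentSpace 𝓘(ℝ, V) y) : ℝ :=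
  coordCovDeriv (metricInChart g y) (formInChart η y) (extChartAt 𝓘(ℝ, V) y y)
    (chartDeriv y v) (fun i ↦ chartDeriv y (w i))

/-- The gradient `∇f`, which satisfies `g(∇f, w) = df(w)`. -/
def riemGradient (g : BilinField V Y) (f : Y → ℝ) (y : Y) : TangentSpace 𝓘(ℝ, V) y :=
  (g y).inverse (mfderiv 𝓘(ℝ, V) 𝓘(ℝ, ℝ) f y : TangentSpace 𝓘(ℝ, V) y →L[ℝ] ℝ)

/-- The Laplace-Beltrami operator `Δ_g f = tr_g (Hess f)`. -/
def laplaceBeltrami (g : BilinField V Y) (f : Y → ℝ) (y : Y) : ℝ :=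
  coordLaplacian (metricInChart g y) (f ∘ (extChartAt 𝓘(ℝ, V) y).symm) (extChartAt 𝓘(ℝ, V) y y)

/-- A smooth function `f` is subharmonic for the metric `g` if `Δ_g f ≥ 0`. -/
def IsSubharmonic (g : BilinField V Y) (f : Y → ℝ) : Prop :=
  ∀ y : Y, 0 ≤ laplaceBeltrami g f y

/-- The operator `d^φ f = ∇f ⌟ φ`. -/
def dPhi {k : ℕ} (g : BilinField V Y) (φ : FormField V Y (k + 1)) (f : Y → ℝ) :
    FormField V Y k := fun y ↦
  contract (V := V) (riemGradient g f y) (φ y)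

/-- An orthonormal family of tangent vectors. -/
def IsOrthonormalFrame {k : ℕ} (g : BilinField V Y) (y : Y)
    (ξ : Fin k → TangentSpace 𝓘(ℝ, V) y) : Prop :=
  ∀ i j, g y (ξ i) (ξ j) = if i = j then 1 else 0

/-- The unit simple `k`-vector `ξ₁ ∧ … ∧ ξ_k` at `y` (with `ξ₁, …, ξ_k` orthonormal) is a
`φ`-plane, that is, an element of `G_y(φ)`. -/
def IsPhiPlane {k : ℕ} (g : BilinField V Y) (φ : FormField V Y k) (y : Y)
    (ξ : Fin k → TangentSpace 𝓘(ℝ, V) y) : Prop :=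
  IsOrthonormalFrame g y ξ ∧ φ y ξ = 1

/-- A calibration of degree `k`: a smooth closed `k`-form with `φ(ξ) ≤ 1` for all unit simple
`k`-vectors `ξ`. -/
structure IsCalibration {k : ℕ} (g : BilinField V Y) (φ : FormField V Y k) : Prop where
  smooth : IsSmoothForm φ
  closed : ∀ y, extDerivForm φ y = 0
  comass_le_one : ∀ (y : Y) (ξ : Fin k → TangentSpace 𝓘(ℝ, V) y),
    IsOrthonormalFrame g y ξ → φ y ξ ≤ 1

/-- A smooth function `f` is `φ`-plurisubharmonic if
`(d d^φ f - ∇_{∇f} φ)(ξ) ≥ 0` for all `φ`-planes `ξ`. -/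
def IsPhiPlurisubharmonic {k : ℕ} (g : BilinField V Y) (φ : FormField V Y (k + 1))
    (f : Y → ℝ) : Prop :=
  ∀ (y : Y) (ξ : Fin (k + 1) → TangentSpace 𝓘(ℝ, V) y), IsPhiPlane g φ y ξ →
    0 ≤ extDerivForm (dPhi g φ f) y ξ - covDerivForm g φ y (riemGradient g f y) ξ

/-- A choice of orientations of the tangent spaces of the `k`-dimensional manifold `Y` is an
orientation of `Y` if it is locally constant in charts. -/
def IsManifoldOrientation {k : ℕ} [IsManifold 𝓘(ℝ, V) ∞ Y]
    (o : ∀ y : Y, Orientation ℝ (TangentSpace 𝓘(ℝ, V) y) (Fin k)) : Prop :=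
  ∀ y₀ : Y, ∃ o₀ : Orientation ℝ V (Fin k), ∀ᶠ y in 𝓝 y₀,
    ∀ hy : y ∈ (trivializationAt V (TangentSpace 𝓘(ℝ, V)) y₀).baseSet,
      Orientation.map (Fin k) ((trivializationAt V (TangentSpace 𝓘(ℝ, V))
        y₀).continuousLinearEquivAt ℝ y hy).toLinearEquiv (o y) = o₀

end Manifold

/-! ### Submanifolds

`X` is a manifold modelled on `V`, and `M ⊆ X` is a subset with the subspace topology and a manifold
structure modelled on `W`. -/

section Submanifold

variable {V : Type*} [NormedAddCommGroup V] [NormedSpace ℝ V]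
  {W : Type*} [NormedAddCommGroup W] [NormedSpace ℝ W]
  {X : Type*} [TopologicalSpace X] [ChartedSpace V X]

/-- The derivative at `m` of the inclusion of `M` in `X`. -/
def inclDeriv (V W : Type*) [NormedAddCommGroup V] [NormedSpace ℝ V]
    [NormedAddCommGroup W] [NormedSpace ℝ W]
    {X : Type*} [TopologicalSpace X] [ChartedSpace V X] (M : Set X) [ChartedSpace W M] (m : M) :
    TangentSpace 𝓘(ℝ, W) m →L[ℝ] TangentSpace 𝓘(ℝ, V) (m : X) :=
  mfderiv 𝓘(ℝ, W) 𝓘(ℝ, V) (Subtype.val : M → X) m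

/-- `M` is a smooth (embedded) submanifold of `X`: the inclusion is a smooth immersion. -/
structure IsSubmanifold (V W : Type*) [NormedAddCommGroup V] [NormedSpace ℝ V]
    [NormedAddCommGroup W] [NormedSpace ℝ W]
    {X : Type*} [TopologicalSpace X] [ChartedSpace V X] (M : Set X) [ChartedSpace W M] :
    Prop where
  isManifold : IsManifold 𝓘(ℝ, W) ∞ M
  contMDiff : ContMDiff 𝓘(ℝ, W) 𝓘(ℝ, V) ∞ (Subtype.val : M → X)
  injective : ∀ m : M, Function.Injective (inclDeriv V W M m)

/-- The metric on `M` induced from the metric `g` of `X`. -/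
def inducedMetric (g : BilinField V X) (M : Set X) [ChartedSpace W M] : BilinField W M := fun m ↦
  ContinuousLinearMap.bilinearComp (E := V) (F := V) (E' := W) (F' := W) (g m)
    (inclDeriv V W M m) (inclDeriv V W M m)

theorem inducedMetric_apply (g : BilinField V X) (M : Set X) [ChartedSpace W M] (m : M)
    (v w : TangentSpace 𝓘(ℝ, W) m) :
    inducedMetric g M m v w = g m (inclDeriv V W M m v) (inclDeriv V W M m w) := rfl

/-- The `k`-vector `ξ₁ ∧ … ∧ ξ_k` is the oriented tangent space of `M` at `m`:
`ξ₁, …, ξ_k` is a positively oriented basis of `T_m M`, viewed in `T_m X`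
(it is only used for orthonormal `ξ`). -/
def IsOrientedTangent {k : ℕ} (M : Set X) [ChartedSpace W M]
    (o : ∀ m : M, Orientation ℝ (TangentSpace 𝓘(ℝ, W) m) (Fin k)) (m : M)
    (ξ : Fin k → TangentSpace 𝓘(ℝ, V) (m : X)) : Prop :=
  ∃ e : Module.Basis (Fin k) ℝ (TangentSpace 𝓘(ℝ, W) m),
    e.orientation = o m ∧ ∀ i, inclDeriv V W M m (e i) = ξ i

/-- The submanifold `M`, oriented by `o`, is a `φ`-submanifold: its oriented unit tangent space at
every point is a `φ`-plane. -/
structure IsPhiSubmanifold {k : ℕ} (g : BilinField V X) (φ : FormField V X k) (M : Set X)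
    [ChartedSpace W M] (o : ∀ m : M, Orientation ℝ (TangentSpace 𝓘(ℝ, W) m) (Fin k)) :
    Prop extends IsSubmanifold V W M where
  orientation : IsManifoldOrientation o
  calibrated : ∀ m : M, ∃ ξ : Fin k → TangentSpace 𝓘(ℝ, V) (m : X),
    IsOrientedTangent M o m ξ ∧ IsPhiPlane g φ m ξ

/-- The calibration `φ` is integrable: every `φ`-plane `ξ` at every point `x` is the oriented
tangent space at `x` of some `φ`-submanifold through `x`. -/
def IsIntegrable {k : ℕ} (g : BilinField V X) (φ : FormField V X k) : Prop :=
  ∀ (x : X) (ξ : Fin k → TangentSpace 𝓘(ℝ, V) x), IsPhiPlane g φ x ξ →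
    ∃ (M : Set X) (_ : ChartedSpace (EuclideanSpace ℝ (Fin k)) M)
      (o : ∀ m : M, Orientation ℝ (TangentSpace 𝓘(ℝ, EuclideanSpace ℝ (Fin k)) m) (Fin k))
      (hx : x ∈ M), IsPhiSubmanifold g φ M o ∧ IsOrientedTangent M o ⟨x, hx⟩ ξ

end Submanifold

end Calibrated

end

open Calibrated

/-! The theorem follows from a pointwise identity
(`extDerivForm_dPhi_sub_covDerivForm_eq_laplaceBeltrami`): if `M` is a `φ`-submanifold and `ξ` is
its oriented unit tangent plane at `m`, then
`(d d^φ f - ∇_{∇f} φ)(ξ) = Δ_M (f|_M)` at `m`. The first part evaluates it on the tangent planes of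
a given `φ`-submanifold; for the second part, integrability provides a `φ`-submanifold tangent to
any given `φ`-plane.

The identity comes from the fact that `φ`-planes maximize `φ` among unit simple vectors. In a form
that can be differentiated without constructing orthonormal frames, this is the Hadamard inequality
`φ(ξ)² ≤ ∏ᵢ g(ξᵢ, ξᵢ)` (`IsCalibrating.sq_apply_le_prod`), with equality on `φ`-planes. Its first
variation (`two_mul_fderiv_apply_eq_sum`) has three consequences.
* Along a parallel frame, it gives `(∇_v φ)(ξ) = 0` for every `v`
  (`coordCovDeriv_eq_zero`), so the term `∇_{∇f} φ` does not contribute.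
* With the base point fixed, it gives `φ(ν, …) = 0` when `ν` is normal to `ξ` and the other
  arguments are tangent. Hence `∇f ⌟ φ` restricts to `∇(f|_M) ⌟ (φ|_M)` on `M`
  (`IsCalibrating.contract_gradient`).
* Along `M`, it says that `φ|_M` is the volume form to first order.

As `d` commutes with the restriction to `M`, the left-hand side is `d(∇(f|_M) ⌟ vol_M)`, the
divergence of the gradient of `f|_M` (`extDeriv_contract_apply`, `coordLaplacian_eq`). -/

/-! ### A Hadamard inequality for forms of comass at most one -/

theorem orthonormal_update_neg {E ι : Type*} [NormedAddCommGroup E] [InnerProductSpace ℝ E]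
    [DecidableEq ι] {b : ι → E} (hb : Orthonormal ℝ b) (i : ι) :
    Orthonormal ℝ (Function.update b i (-b i)) := by
  rw [orthonormal_iff_ite] at hb ⊢
  intro j l
  have h1 := hb i i
  have h2 := hb j l
  have h3 := hb i l
  have h4 := hb j i
  simp only [Function.update_apply]
  split_ifs <;> simp_all [inner_neg_left, inner_neg_right, -inner_self_eq_norm_sq_to_K]

/-- Restricted to the span of `v`, the form `ψ` is a multiple, by a factor in `[-1, 1]`, of the
volume form, for which this is the Hadamard inequality. -/
theorem abs_apply_le_prod_norm {E : Type*} [NormedAddCommGroup E] [InnerProductSpace ℝ E] {k : ℕ}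
    (ψ : E [⋀^Fin (k + 1)]→ₗ[ℝ] ℝ) (hψ : ∀ v, Orthonormal ℝ v → ψ v ≤ 1)
    (v : Fin (k + 1) → E) : |ψ v| ≤ ∏ i, ‖v i‖ := by
  by_cases hv : LinearIndependent ℝ v
  · have hfr : Module.finrank ℝ (Submodule.span ℝ (Set.range v)) = k + 1 := by
      simpa using finrank_span_eq_card hv
    set S := Submodule.span ℝ (Set.range v)
    have : FiniteDimensional ℝ S := Module.finite_of_finrank_eq_succ hfr
    have : Fact (Module.finrank ℝ S = k + 1) := ⟨hfr⟩
    let b : OrthonormalBasis (Fin (k + 1)) ℝ S := (stdOrthonormalBasis ℝ S).reindex (finCongr hfr)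
    let v' : Fin (k + 1) → S := fun i ↦ ⟨v i, Submodule.subset_span ⟨i, rfl⟩⟩
    have hb : Orthonormal ℝ (fun i ↦ (b i : E)) :=
      b.orthonormal.comp_linearIsometry S.subtypeₗᵢ
    have h1 : |ψ (fun i ↦ (b i : E))| ≤ 1 := by
      -- The lower bound is the upper bound for the opposite orientation.
      refine abs_le.2 ⟨?_, hψ _ hb⟩
      have := hψ _ (orthonormal_update_neg hb 0)
      rw [AlternatingMap.map_update_neg, Function.update_eq_self] at this
      linarith
    have h2 : ψ v = ψ (fun i ↦ (b i : E)) * b.toBasis.det v' := by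
      have := congrArg (fun θ ↦ θ v') (AlternatingMap.eq_smul_basis_det b.toBasis
        (ψ.compLinearMap S.subtype))
      simpa [v', Function.comp_def] using this
    have h3 := b.toBasis.orientation.abs_volumeForm_apply_le v'
    rw [Orientation.volumeForm_robust _ b rfl] at h3
    calc |ψ v| = |ψ (fun i ↦ (b i : E))| * |b.toBasis.det v'| := by rw [h2, abs_mul]
      _ ≤ 1 * ∏ i, ‖v' i‖ := by gcongr
      _ = ∏ i, ‖v i‖ := by simp [v']
  · rw [ψ.map_linearDependent v hv, abs_zero]
    positivity

/-- The same inequality for the inner product `B`. -/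
theorem sq_apply_le_prod {V : Type*} [AddCommGroup V] [Module ℝ V] {k : ℕ}
    (B : V → V → ℝ) (hadd : ∀ u v w, B (u + v) w = B u w + B v w)
    (hsmul : ∀ (c : ℝ) u w, B (c • u) w = c * B u w) (hsymm : ∀ v w, B v w = B w v)
    (hpos : ∀ v, v ≠ 0 → 0 < B v v) (ψ : V [⋀^Fin (k + 1)]→ₗ[ℝ] ℝ)
    (hψ : ∀ v : Fin (k + 1) → V, (∀ i j, B (v i) (v j) = if i = j then 1 else 0) → ψ v ≤ 1)
    (v : Fin (k + 1) → V) : ψ v ^ 2 ≤ ∏ i, B (v i) (v i) := by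
  have h0 : B 0 0 = 0 := by simpa using hsmul 0 0 0
  let core : InnerProductSpace.Core ℝ V :=
    { inner := B
      conj_inner_symm := fun x y ↦ hsymm y x
      re_inner_nonneg := fun x ↦ by
        rcases eq_or_ne x 0 with rfl | hx
        · exact h0.ge
        · exact (hpos x hx).le
      add_left := hadd
      smul_left := fun x y r ↦ hsmul r x y
      definite := fun x hx ↦ by
        by_contra h
        exact (hpos x h).ne' hx }
  let _ : NormedAddCommGroup V := core.toNormedAddCommGroup
  let _ : InnerProductSpace ℝ V := InnerProductSpace.ofCore core.toCore
  have hin : ∀ x y : V, inner ℝ x y = B x y := fun _ _ ↦ rfl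
  have h := abs_apply_le_prod_norm ψ (fun v hv ↦ hψ v (orthonormal_iff_ite.1 hv)) v
  calc ψ v ^ 2 = |ψ v| ^ 2 := (sq_abs _).symm
    _ ≤ (∏ i, ‖v i‖) ^ 2 := by gcongr
    _ = ∏ i, B (v i) (v i) := by
      rw [← Finset.prod_pow]
      exact Finset.prod_congr rfl fun i _ ↦ by rw [← hin, real_inner_self_eq_norm_sq]

/-! ### Calibrated planes in an inner product space -/

/-- The analogue of `IsPhiPlane` for one inner product `B` and one form `ψ` on a vector space:
`ξ` is `B`-orthonormal and `ψ` takes the value one on it. -/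
def IsCalibratedFrame {V : Type*} [NormedAddCommGroup V] [NormedSpace ℝ V] {k : ℕ}
    (B : V →L[ℝ] V →L[ℝ] ℝ) (ψ : V [⋀^Fin k]→L[ℝ] ℝ) (ξ : Fin k → V) : Prop :=
  (∀ i j, B (ξ i) (ξ j) = if i = j then 1 else 0) ∧ ψ ξ = 1

/-- `B` is an inner product for which the form `ψ` has comass at most one. -/
structure IsCalibrating {V : Type*} [NormedAddCommGroup V] [NormedSpace ℝ V] {k : ℕ}
    (B : V →L[ℝ] V →L[ℝ] ℝ) (ψ : V [⋀^Fin k]→L[ℝ] ℝ) : Prop where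
  symm : ∀ v w, B v w = B w v
  pos : ∀ v, v ≠ 0 → 0 < B v v
  apply_le_one : ∀ ξ : Fin k → V, (∀ i j, B (ξ i) (ξ j) = if i = j then 1 else 0) → ψ ξ ≤ 1

theorem isInvertible_of_pos {V : Type*} [NormedAddCommGroup V] [NormedSpace ℝ V]
    [FiniteDimensional ℝ V] {B : V →L[ℝ] V →L[ℝ] ℝ} (hB : ∀ v, v ≠ 0 → 0 < B v v) :
    B.IsInvertible := by
  have hinj : Function.Injective (B : V →ₗ[ℝ] V →L[ℝ] ℝ) := by
    rw [injective_iff_map_eq_zero]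
    intro v hv
    by_contra h
    have := hB v h
    rw [show B v = 0 from hv] at this
    simp at this
  have hfr : Module.finrank ℝ V = Module.finrank ℝ (V →L[ℝ] ℝ) := by
    rw [← (LinearMap.toContinuousLinearMap : (V →ₗ[ℝ] ℝ) ≃ₗ[ℝ] (V →L[ℝ] ℝ)).finrank_eq]
    exact (Subspace.dual_finrank_eq (K := ℝ) (V := V)).symm
  exact ⟨(LinearEquiv.ofInjectiveOfFinrankEq (B : V →ₗ[ℝ] V →L[ℝ] ℝ) hinj
    hfr).toContinuousLinearEquiv, by ext; rfl⟩

/-- If `a² ≤ ∏ bᵢ` near a point where `a` and the `bᵢ` equal one, then the difference has a minimum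
there. -/
theorem two_mul_fderiv_eq_sum_of_sq_le_prod {E ι : Type*} [NormedAddCommGroup E] [NormedSpace ℝ E]
    [Fintype ι] {a : E → ℝ} {b : ι → E → ℝ} {x : E} (ha : DifferentiableAt ℝ a x)
    (hb : ∀ i, DifferentiableAt ℝ (b i) x) (ha1 : a x = 1) (hb1 : ∀ i, b i x = 1)
    (h : ∀ᶠ y in 𝓝 x, a y ^ 2 ≤ ∏ i, b i y) (v : E) :
    2 * fderiv ℝ a x v = ∑ i, fderiv ℝ (b i) x v := by
  classical
  have hd := (HasFDerivAt.finsetProd (u := Finset.univ) fun i _ ↦ (hb i).hasFDerivAt).sub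
    (ha.hasFDerivAt.pow 2)
  have hmin : IsLocalMin ((fun y ↦ ∏ i, b i y) - fun y ↦ a y ^ 2) x := by
    filter_upwards [h] with y hy
    simpa [ha1, hb1] using hy
  have := congrArg (fun l ↦ l v) (hmin.hasFDerivAt_eq_zero hd)
  simp [ha1, hb1] at this
  linarith

section

variable {V : Type*} [NormedAddCommGroup V] [NormedSpace ℝ V] {k : ℕ}

theorem IsCalibrating.sq_apply_le_prod {B : V →L[ℝ] V →L[ℝ] ℝ} {ψ : V [⋀^Fin (k + 1)]→L[ℝ] ℝ}
    (h : IsCalibrating B ψ) (v : Fin (k + 1) → V) : ψ v ^ 2 ≤ ∏ i, B (v i) (v i) :=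
  _root_.sq_apply_le_prod (fun v w ↦ B v w) (by simp) (by simp) h.symm h.pos ψ.toAlternatingMap
    h.apply_le_one v

theorem fderiv_apply_self {E : Type*} [NormedAddCommGroup E] [NormedSpace ℝ E]
    {B : E → V →L[ℝ] V →L[ℝ] ℝ} {ξ : E → V} {x : E} (hB : DifferentiableAt ℝ B x)
    (hξ : DifferentiableAt ℝ ξ x) (hsymm : ∀ v w, B x v w = B x w v) :
    DifferentiableAt ℝ (fun y ↦ B y (ξ y) (ξ y)) x ∧
      ∀ v, fderiv ℝ (fun y ↦ B y (ξ y) (ξ y)) x v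
        = fderiv ℝ B x v (ξ x) (ξ x) + 2 * B x (fderiv ℝ ξ x v) (ξ x) := by
  have h := (hB.hasFDerivAt.clm_apply hξ.hasFDerivAt).clm_apply hξ.hasFDerivAt
  refine ⟨h.differentiableAt, fun v ↦ ?_⟩
  rw [h.fderiv]
  simp [hsymm (ξ x)]
  ring

/-- First variation of a calibration: calibrated planes maximize the calibration among all planes,
so its derivative in a family of frames is half the derivative of the sum of the squared lengths. -/
theorem two_mul_fderiv_apply_eq_sum {E : Type*} [NormedAddCommGroup E] [NormedSpace ℝ E]
    {B : E → V →L[ℝ] V →L[ℝ] ℝ} {ψ : E → V [⋀^Fin (k + 1)]→L[ℝ] ℝ} {ξ : Fin (k + 1) → E → V}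
    {x : E} (hcal : ∀ᶠ y in 𝓝 x, IsCalibrating (B y) (ψ y)) (hB : DifferentiableAt ℝ B x)
    (hψ : DifferentiableAt ℝ ψ x) (hξ : ∀ i, DifferentiableAt ℝ (ξ i) x)
    (hx : IsCalibratedFrame (B x) (ψ x) (ξ · x)) (v : E) :
    2 * fderiv ℝ (fun y ↦ ψ y (ξ · y)) x v
      = ∑ i, (fderiv ℝ B x v (ξ i x) (ξ i x) + 2 * B x (fderiv ℝ (ξ i) x v) (ξ i x)) := by
  have hsymm := hcal.self_of_nhds.symm
  rw [two_mul_fderiv_eq_sum_of_sq_le_prod (b := fun i y ↦ B y (ξ i y) (ξ i y))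
    (hψ.hasFDerivAt.continuousAlternatingMap_apply
      fun i ↦ (hξ i).hasFDerivAt).differentiableAt (fun i ↦ (fderiv_apply_self hB (hξ i) hsymm).1)
    hx.2 (fun i ↦ by simpa using hx.1 i i) ?_ v]
  · exact Finset.sum_congr rfl fun i _ ↦ (fderiv_apply_self hB (hξ i) hsymm).2 v
  · filter_upwards [hcal] with y hy using hy.sq_apply_le_prod _

/-- First cousin principle: on a plane obtained from a calibrated plane by replacing one of the
frame vectors by `v`, the calibration only sees the component of `v` along that frame vector. -/
theorem IsCalibrating.apply_update {B : V →L[ℝ] V →L[ℝ] ℝ} {ψ : V [⋀^Fin (k + 1)]→L[ℝ] ℝ}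
    (h : IsCalibrating B ψ) {ξ : Fin (k + 1) → V} (hξ : IsCalibratedFrame B ψ ξ)
    (i : Fin (k + 1)) (v : V) : ψ (Function.update ξ i v) = B v (ξ i) := by
  let Ξ : Fin (k + 1) → V → V := fun j w ↦ ξ j + if j = i then w else 0
  have hΞ : ∀ j, DifferentiableAt ℝ (Ξ j) 0 := fun j ↦ by
    simp only [Ξ]; split_ifs <;> fun_prop
  have hΞ0 : ∀ j, Ξ j 0 = ξ j := by simp [Ξ]
  have hΞd : ∀ j, fderiv ℝ (Ξ j) 0 v = if j = i then v else 0 := fun j ↦ by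
    simp only [Ξ, fderiv_const_add]; split_ifs <;> simp
  have := two_mul_fderiv_apply_eq_sum (x := (0 : V)) (.of_forall fun _ ↦ h)
    (differentiableAt_const B) (differentiableAt_const ψ) hΞ (by simpa only [hΞ0] using hξ) v
  rw [fderiv_continuousAlternatingMap_apply_apply (differentiableAt_const ψ) hΞ] at this
  have h6 : ∀ j, ψ (Function.update ξ j (if j = i then v else 0))
      = if j = i then ψ (Function.update ξ i v) else 0 := by
    intro j
    split_ifs with hj
    · rw [hj]
    · exact ψ.map_coord_zero j (by simp)
  have h7 : ∀ j, B (if j = i then v else 0) (ξ j) = if j = i then B v (ξ i) else 0 := by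
    intro j
    split_ifs with hj
    · rw [hj]
    · simp
  simpa [hΞ0, hΞd, h6, h7] using this

/-- A calibration is stationary on calibrated planes under parallel transport. The frame used here,
with derivative `-Γ(v, ξᵢ)`, is parallel to first order. -/
theorem coordCovDeriv_eq_zero [FiniteDimensional ℝ V] {G : V → V →L[ℝ] V →L[ℝ] ℝ}
    {η : V → V [⋀^Fin (k + 1)]→L[ℝ] ℝ} {x : V}
    (hcal : ∀ᶠ y in 𝓝 x, IsCalibrating (G y) (η y)) (hG : DifferentiableAt ℝ G x)
    (hη : DifferentiableAt ℝ η x) {ξ : Fin (k + 1) → V}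
    (hξ : IsCalibratedFrame (G x) (η x) ξ) (v : V) : coordCovDeriv G η x v ξ = 0 := by
  have hx := hcal.self_of_nhds
  let Γ : V → V →L[ℝ] V := fun w ↦ LinearMap.toContinuousLinearMap
    { toFun := fun u ↦ christoffel G x u w
      map_add' := by simp [christoffel_add]
      map_smul' := by simp [christoffel_smul] }
  let Ξ : Fin (k + 1) → V → V := fun j y ↦ ξ j - Γ (ξ j) (y - x)
  have hΞd : ∀ j, HasFDerivAt (Ξ j) (-Γ (ξ j)) x := fun j ↦ by
    simpa [Ξ, Function.comp_def] using
      ((Γ (ξ j)).hasFDerivAt.comp x ((hasFDerivAt_id x).sub_const x)).const_sub (ξ j)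
  have hΞ0 : ∀ j, Ξ j x = ξ j := by simp [Ξ]
  have := two_mul_fderiv_apply_eq_sum hcal hG hη (fun j ↦ (hΞd j).differentiableAt)
    (by simpa only [hΞ0] using hξ) v
  rw [fderiv_continuousAlternatingMap_apply_apply hη (fun j ↦ (hΞd j).differentiableAt)] at this
  have h1 : ∀ j, fderiv ℝ G x v (ξ j) (ξ j) + 2 * G x (-christoffel G x v (ξ j)) (ξ j) = 0 := by
    intro j
    have := christoffel_spec G x (isInvertible_of_pos hx.pos) v (ξ j) (ξ j)
    simp only [map_neg, neg_apply]
    linarith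
  have h2 : ∀ j, fderiv ℝ (Ξ j) x v = -christoffel G x v (ξ j) := fun j ↦ by
    rw [(hΞd j).fderiv]; rfl
  have h3 : ∀ j w, η x (Function.update ξ j (-w)) = -η x (Function.update ξ j w) := fun j w ↦
    (η x).toAlternatingMap.map_update_neg ξ j w
  simp only [hΞ0, h2, h1, h3, Finset.sum_neg_distrib, Finset.sum_const_zero] at this
  rw [coordCovDeriv]
  linarith

end

/-! ### Stokes' formula for the contraction of a vector field with a top degree form -/

section

variable {V W : Type*} [NormedAddCommGroup V] [NormedSpace ℝ V] [NormedAddCommGroup W]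
  [NormedSpace ℝ W] {k : ℕ}

theorem contract_apply_removeNth (ω' : W [⋀^Fin (k + 1)]→L[ℝ] ℝ)
    (e : Module.Basis (Fin (k + 1)) ℝ W) (v : W) (i : Fin (k + 1)) :
    contract v ω' (i.removeNth e) = (-1) ^ (i : ℕ) * (e.repr v i * ω' e) := by
  have h1 : ω' (Matrix.vecCons v (i.removeNth e))
      = (-1) ^ (i : ℕ) * ω' (i.insertNth v (i.removeNth e)) := by
    have := ω'.toAlternatingMap.neg_one_pow_smul_map_insertNth i v (i.removeNth e)
    simpa using this.symm
  rw [contract_apply, h1, Fin.insertNth_removeNth]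
  congr 1
  conv_lhs => rw [← e.sum_repr v]
  have := ω'.toAlternatingMap.map_update_sum Finset.univ i (fun j ↦ e.repr v j • e j) e
  simp only [ContinuousAlternatingMap.coe_toAlternatingMap] at this
  rw [this, Finset.sum_eq_single i]
  · rw [ω'.map_update_smul, Function.update_eq_self, smul_eq_mul]
  · intro j _ hj
    rw [ω'.map_update_smul, ω'.map_eq_zero_of_eq (i := i) (j := j) _ (by simp [hj]) hj.symm,
      smul_zero]
  · simp

theorem differentiableAt_contract {Y : V → V} {η : V → V [⋀^Fin (k + 1)]→L[ℝ] ℝ} {x : V}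
    (hY : DifferentiableAt ℝ Y x) (hη : DifferentiableAt ℝ η x) :
    DifferentiableAt ℝ (fun y ↦ contract (Y y) (η y)) x := by
  have hT : DifferentiableAt ℝ (fun ψ : V [⋀^Fin (k + 1)]→L[ℝ] ℝ ↦ ψ.curryLeft) (η x) :=
    (ContinuousAlternatingMap.curryLeftLI (𝕜 := ℝ) (E := V) (F := ℝ)
      (n := k)).toContinuousLinearMap.differentiableAt
  have h := DifferentiableAt.comp (G := V →L[ℝ] V [⋀^Fin k]→L[ℝ] ℝ) x hT hη
  exact h.clm_apply hY

/-- In a basis `e`, the exterior derivative of `Y ⌟ θ` is `(D_Y θ + (tr DY) θ)(e)`, the Lie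
derivative of the top degree form `θ`. -/
theorem extDeriv_contract_apply {Y : W → W} {θ : W → W [⋀^Fin (k + 1)]→L[ℝ] ℝ} {z : W}
    (hY : DifferentiableAt ℝ Y z) (hθ : DifferentiableAt ℝ θ z)
    (e : Module.Basis (Fin (k + 1)) ℝ W) :
    extDeriv (fun y ↦ contract (Y y) (θ y)) z e
      = fderiv ℝ (fun y ↦ θ y e) z (Y z) + (∑ i, e.repr (fderiv ℝ Y z (e i)) i) * θ z e := by
  have : FiniteDimensional ℝ W := e.finiteDimensional_of_finite
  rw [extDeriv_apply (differentiableAt_contract hY hθ)]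
  have hθe : DifferentiableAt ℝ (fun y ↦ θ y e) z :=
    (hθ.hasFDerivAt.continuousAlternatingMap_apply
      fun i ↦ hasFDerivAt_const (e i) z).differentiableAt
  have h1 : ∀ i, fderiv ℝ (fun y ↦ contract (Y y) (θ y) (i.removeNth e)) z (e i)
      = (-1) ^ (i : ℕ) * (e.repr (fderiv ℝ Y z (e i)) i * θ z e
        + e.repr (Y z) i * fderiv ℝ (fun y ↦ θ y e) z (e i)) := by
    intro i
    simp_rw [contract_apply_removeNth]
    have hc : HasFDerivAt (fun y ↦ e.repr (Y y) i)
        ((LinearMap.toContinuousLinearMap (e.coord i)).comp (fderiv ℝ Y z)) z :=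
      (LinearMap.toContinuousLinearMap (e.coord i)).hasFDerivAt.comp z hY.hasFDerivAt
    have h2 := ((hc.mul hθe.hasFDerivAt).const_mul ((-1) ^ (i : ℕ))).fderiv
    simp only [Pi.mul_apply] at h2
    rw [h2]
    simp
    ring
  have h2 : fderiv ℝ (fun y ↦ θ y e) z (Y z)
      = ∑ i, e.repr (Y z) i * fderiv ℝ (fun y ↦ θ y e) z (e i) := by
    conv_lhs => rw [← e.sum_repr (Y z), map_sum]
    simp
  have h3 : ∀ i : Fin (k + 1), ((-1 : ℝ) ^ (i : ℕ)) * (-1) ^ (i : ℕ) = 1 := fun i ↦ by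
    rw [← mul_pow]; simp
  simp_rw [h1, h2, zsmul_eq_mul, Int.cast_pow, Int.cast_neg, Int.cast_one, ← mul_assoc, h3,
    one_mul]
  rw [Finset.sum_add_distrib, Finset.sum_mul, add_comm]

end

/-! ### The Laplace-Beltrami operator in coordinates -/

section

variable {V W : Type*} [NormedAddCommGroup V] [NormedSpace ℝ V] [NormedAddCommGroup W]
  [NormedSpace ℝ W] {k : ℕ}

theorem repr_eq_of_orthonormal {ι : Type*} [Fintype ι] [DecidableEq ι] {B : W →L[ℝ] W →L[ℝ] ℝ}
    (e : Module.Basis ι ℝ W) (he : ∀ i j, B (e i) (e j) = if i = j then 1 else 0) (v : W) (i : ι) :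
    e.repr v i = B v (e i) := by
  conv_rhs => rw [← e.sum_repr v, map_sum, sum_apply]
  simp [he]

theorem fderiv_symm {E : Type*} [NormedAddCommGroup E] [NormedSpace ℝ E]
    {B : E → V →L[ℝ] V →L[ℝ] ℝ} {x : E} (hB : DifferentiableAt ℝ B x)
    (hsymm : ∀ᶠ y in 𝓝 x, ∀ v w, B y v w = B y w v) (u : E) (v w : V) :
    fderiv ℝ B x u v w = fderiv ℝ B x u w v := by
  have key : ∀ v w : V, fderiv ℝ (fun y ↦ B y v w) x u = fderiv ℝ B x u v w := fun v w ↦ by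
    have h := (hB.hasFDerivAt.clm_apply (hasFDerivAt_const v x)).clm_apply (hasFDerivAt_const w x)
    rw [h.fderiv]
    simp
  rw [← key, ← key]
  congr 1
  apply Filter.EventuallyEq.fderiv_eq
  filter_upwards [hsymm] with y hy using hy v w

theorem differentiableAt_inverse_apply [FiniteDimensional ℝ V] {G : V → V →L[ℝ] V →L[ℝ] ℝ}
    {α : V → V →L[ℝ] ℝ} {x : V} (hG : DifferentiableAt ℝ G x) (hα : DifferentiableAt ℝ α x)
    (hpos : ∀ v, v ≠ 0 → 0 < G x v v) : DifferentiableAt ℝ (fun y ↦ (G y).inverse (α y)) x := by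
  have : CompleteSpace V := FiniteDimensional.complete ℝ V
  have h := ((isInvertible_of_pos hpos).contDiffAt_map_inverse (n := 1)).differentiableAt (by simp)
  exact (h.comp x hG).clm_apply hα

/-- `Δu` is the divergence of the gradient of `u` for the volume density of the metric: the second
sum is the logarithmic derivative of the density in the direction of the gradient. -/
theorem coordLaplacian_eq {G : W → W →L[ℝ] W →L[ℝ] ℝ} {u : W → ℝ} {z : W}
    (hG : DifferentiableAt ℝ G z) (hsymm : ∀ᶠ y in 𝓝 z, ∀ v w, G y v w = G y w v)
    (hpos : ∀ᶠ y in 𝓝 z, ∀ v, v ≠ 0 → 0 < G y v v) (hu : ContDiffAt ℝ 2 u z)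
    {ι : Type*} [Fintype ι] [DecidableEq ι]
    (e : Module.Basis ι ℝ W) (he : ∀ i j, G z (e i) (e j) = if i = j then 1 else 0) :
    coordLaplacian G u z
      = ∑ i, (e.repr (fderiv ℝ (fun y ↦ (G y).inverse (fderiv ℝ u y)) z (e i)) i
        + 1 / 2 * fderiv ℝ G z ((G z).inverse (fderiv ℝ u z)) (e i) (e i)) := by
  have : FiniteDimensional ℝ W := e.finiteDimensional_of_finite
  set Y : W → W := fun y ↦ (G y).inverse (fderiv ℝ u y) with hYdef
  have hdu : DifferentiableAt ℝ (fderiv ℝ u) z :=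
    (hu.fderiv_right (m := 1) (by norm_num)).differentiableAt (by simp)
  have hY : DifferentiableAt ℝ Y z := differentiableAt_inverse_apply hG hdu hpos.self_of_nhds
  have hinv := isInvertible_of_pos hpos.self_of_nhds
  have hGY : G z (Y z) = fderiv ℝ u z := hinv.self_apply_inverse _
  have hduY : ∀ v w, fderiv ℝ (fderiv ℝ u) z v w
      = fderiv ℝ G z v (Y z) w + G z (fderiv ℝ Y z v) w := by
    intro v w
    have h1 : fderiv ℝ u =ᶠ[𝓝 z] fun y ↦ G y (Y y) := by
      filter_upwards [hpos] with y hy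
      exact ((isInvertible_of_pos hy).self_apply_inverse _).symm
    rw [h1.fderiv_eq, (hG.hasFDerivAt.clm_apply hY.hasFDerivAt).fderiv]
    simp [add_comm]
  rw [coordLaplacian, LinearMap.trace_eq_matrix_trace ℝ e, Matrix.trace]
  refine Finset.sum_congr rfl fun i _ ↦ ?_
  rw [Matrix.diag_apply, LinearMap.toMatrix_apply, repr_eq_of_orthonormal e he,
    repr_eq_of_orthonormal e he]
  have h2 : G z (coordHessianEnd G u z (e i)) (e i) = coordHessian G u z (e i) (e i) := by
    change G z ((G z).inverse _) (e i) = _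
    rw [hinv.self_apply_inverse]
  have h3 := christoffel_spec G z hinv (e i) (e i) (Y z)
  rw [h2, coordHessian]
  simp only [sub_apply, ContinuousLinearMap.comp_apply]
  rw [hduY, ← hGY, hsymm.self_of_nhds (Y z), fderiv_symm hG hsymm _ (Y z),
    show (G z).inverse (G z (Y z)) = Y z from hinv.inverse_apply_self _]
  linarith

end

/-! ### The two sides of the theorem in coordinates -/

section

variable {V W : Type*} [NormedAddCommGroup V] [NormedSpace ℝ V] [NormedAddCommGroup W]
  [NormedSpace ℝ W] {k : ℕ}

/-- A calibration vanishes on planes spanned by a normal vector `v` and tangent vectors of a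
calibrated plane, spanned by `A (e i)`. -/
theorem IsCalibrating.contract_comp_eq_zero {B : V →L[ℝ] V →L[ℝ] ℝ}
    {ψ : V [⋀^Fin (k + 1)]→L[ℝ] ℝ} (h : IsCalibrating B ψ) (A : W →L[ℝ] V)
    (e : Module.Basis (Fin (k + 1)) ℝ W) (he : IsCalibratedFrame B ψ (fun i ↦ A (e i))) {v : V}
    (hv : ∀ w, B v (A w) = 0) : (contract v ψ).compContinuousLinearMap A = 0 := by
  apply ContinuousAlternatingMap.toAlternatingMap_injective
  refine Module.Basis.ext_alternating e fun j hj ↦ ?_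
  -- The indices `j` omit exactly one `i`; up to a permutation, `v` replaces the frame vector `i`.
  obtain ⟨i, hi⟩ : ∃ i, ∀ l, j l ≠ i := by
    by_contra! hc
    have := Fintype.card_le_of_surjective j hc
    simp at this
  have hσ : Function.Injective (Matrix.vecCons i j : Fin (k + 1) → Fin (k + 1)) :=
    Fin.cons_injective_iff.2 ⟨fun ⟨l, hl⟩ ↦ hi l hl, hj⟩
  let σ : Equiv.Perm (Fin (k + 1)) := Equiv.ofBijective _ (Finite.injective_iff_bijective.1 hσ)
  have h1 : Matrix.vecCons v (fun l ↦ A (e (j l)))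
      = fun l ↦ Function.update (fun i ↦ A (e i)) i v (σ l) := by
    ext l
    refine Fin.cases ?_ (fun l ↦ ?_) l
    · simp [σ]
    · simp [σ, hi l]
  have h2 := ψ.toAlternatingMap.map_perm (Function.update (fun i ↦ A (e i)) i v) σ
  have h3 : ψ (Function.update (fun i ↦ A (e i)) i v) = 0 := by
    rw [h.apply_update he, hv]
  change ψ (Matrix.vecCons v fun l ↦ A (e (j l))) = 0
  rw [h1]
  refine h2.trans ?_
  rw [show ψ.toAlternatingMap _ = (0 : ℝ) from h3, smul_zero]

/-- The metric `A^* B` induced from `B` by a linear map `A`. -/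
noncomputable def pullbackBilin (A : W →L[ℝ] V) (B : V →L[ℝ] V →L[ℝ] ℝ) : W →L[ℝ] W →L[ℝ] ℝ :=
  B.bilinearComp A A

theorem pullbackBilin_apply (A : W →L[ℝ] V) (B : V →L[ℝ] V →L[ℝ] ℝ) (v w : W) :
    pullbackBilin A B v w = B (A v) (A w) := rfl

theorem DifferentiableAt.clm_flip {E : Type*} [NormedAddCommGroup E] [NormedSpace ℝ E]
    {L : E → V →L[ℝ] W →L[ℝ] ℝ} {z : E} (hL : DifferentiableAt ℝ L z) :
    DifferentiableAt ℝ (fun y ↦ (L y).flip) z := by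
  have h : DifferentiableAt ℝ (fun L : V →L[ℝ] W →L[ℝ] ℝ ↦ L.flip) (L z) :=
    ContinuousLinearEquiv.differentiableAt (𝕜 := ℝ) (E := V →L[ℝ] W →L[ℝ] ℝ)
      (F := W →L[ℝ] V →L[ℝ] ℝ) (ContinuousLinearMap.flipₗᵢ ℝ V W ℝ).toContinuousLinearEquiv
  exact DifferentiableAt.comp (𝕜 := ℝ) (F := V →L[ℝ] W →L[ℝ] ℝ) (G := W →L[ℝ] V →L[ℝ] ℝ) z h hL

theorem DifferentiableAt.pullbackBilin {E : Type*} [NormedAddCommGroup E] [NormedSpace ℝ E]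
    {A : E → W →L[ℝ] V} {B : E → V →L[ℝ] V →L[ℝ] ℝ} {z : E} (hA : DifferentiableAt ℝ A z)
    (hB : DifferentiableAt ℝ B z) : DifferentiableAt ℝ (fun y ↦ pullbackBilin (A y) (B y)) z := by
  have h : DifferentiableAt ℝ (fun y ↦ (B y).comp (A y)) z := hB.clm_comp hA
  exact (h.clm_flip.clm_comp hA).clm_flip

/-- An injective linear map pulls back inner products to inner products. -/
theorem pullbackBilin_pos {A : W →L[ℝ] V} (hA : Function.Injective A) {B : V →L[ℝ] V →L[ℝ] ℝ}
    (hB : ∀ v, v ≠ 0 → 0 < B v v) (v : W) (hv : v ≠ 0) : 0 < pullbackBilin A B v v :=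
  hB _ fun h ↦ hv (hA (h.trans (map_zero A).symm))

theorem IsCalibrating.pullback {B : V →L[ℝ] V →L[ℝ] ℝ} {ψ : V [⋀^Fin k]→L[ℝ] ℝ}
    (h : IsCalibrating B ψ) {A : W →L[ℝ] V} (hA : Function.Injective A) :
    IsCalibrating (pullbackBilin A B) (ψ.compContinuousLinearMap A) where
  symm _ _ := h.symm _ _
  pos := pullbackBilin_pos hA h.pos
  apply_le_one _ hξ := h.apply_le_one _ hξ

/-- Along a calibrated plane, contracting a calibration with the gradient of a function is the same
as contracting with the gradient of the restriction, as the difference of the two is normal. -/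
theorem IsCalibrating.contract_gradient [FiniteDimensional ℝ V] {B : V →L[ℝ] V →L[ℝ] ℝ}
    {ψ : V [⋀^Fin (k + 1)]→L[ℝ] ℝ} (h : IsCalibrating B ψ) {A : W →L[ℝ] V}
    (hA : Function.Injective A) (e : Module.Basis (Fin (k + 1)) ℝ W)
    (he : IsCalibratedFrame B ψ (fun i ↦ A (e i))) (α : V →L[ℝ] ℝ) :
    (contract (B.inverse α) ψ).compContinuousLinearMap A
      = contract ((pullbackBilin A B).inverse (α.comp A)) (ψ.compContinuousLinearMap A) := by
  have : FiniteDimensional ℝ W := e.finiteDimensional_of_finite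
  set Y := (pullbackBilin A B).inverse (α.comp A)
  have hY : ∀ w, B (A Y) (A w) = α (A w) := fun w ↦ by
    rw [← pullbackBilin_apply,
      (isInvertible_of_pos (pullbackBilin_pos hA h.pos)).self_apply_inverse]
    rfl
  have h1 := h.contract_comp_eq_zero A e he (v := B.inverse α - A Y) fun w ↦ by
    rw [map_sub, sub_apply, hY, (isInvertible_of_pos h.pos).self_apply_inverse, sub_self]
  have h2 : (contract (A Y) ψ).compContinuousLinearMap A
      = contract Y (ψ.compContinuousLinearMap A) := by
    ext w
    change ψ (Matrix.vecCons (A Y) fun i ↦ A (w i)) = ψ fun i ↦ A ((Matrix.vecCons Y w) i)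
    congr 1
    ext l
    refine Fin.cases ?_ (fun l ↦ ?_) l <;> simp
  rw [← h2]
  ext w
  have h3 := congrArg (fun l ↦ l w) h1
  have h4 : contract (B.inverse α - A Y) ψ = contract (B.inverse α) ψ - contract (A Y) ψ :=
    map_sub ψ.curryLeft _ _
  rw [h4] at h3
  exact sub_eq_zero.1 h3

/-- For a map `F : W → V` that parametrizes a `φ`-submanifold, `(d d^φ f - ∇_{∇f} φ)(ξ)` equals the
Laplacian of `f` on that submanifold. -/
theorem extDeriv_sub_coordCovDeriv_eq_coordLaplacian [FiniteDimensional ℝ V]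
    {G : V → V →L[ℝ] V →L[ℝ] ℝ} {η : V → V [⋀^Fin (k + 1)]→L[ℝ] ℝ} {h : V → ℝ} {F : W → V} {z : W}
    (hcal : ∀ᶠ y in 𝓝 (F z), IsCalibrating (G y) (η y)) (hG : DifferentiableAt ℝ G (F z))
    (hη : DifferentiableAt ℝ η (F z)) (hh : ContDiffAt ℝ 2 h (F z)) (hF : ContDiffAt ℝ 2 F z)
    (hFinj : ∀ᶠ y in 𝓝 z, Function.Injective (fderiv ℝ F y))
    (hsub : ∀ᶠ y in 𝓝 z, ∃ e : Module.Basis (Fin (k + 1)) ℝ W,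
      IsCalibratedFrame (G (F y)) (η (F y)) (fun i ↦ fderiv ℝ F y (e i)))
    (e : Module.Basis (Fin (k + 1)) ℝ W)
    (he : IsCalibratedFrame (G (F z)) (η (F z)) (fun i ↦ fderiv ℝ F z (e i))) :
    extDeriv (fun y ↦ contract ((G y).inverse (fderiv ℝ h y)) (η y)) (F z)
        (fun i ↦ fderiv ℝ F z (e i))
      - coordCovDeriv G η (F z) ((G (F z)).inverse (fderiv ℝ h (F z)))
        (fun i ↦ fderiv ℝ F z (e i))
      = coordLaplacian (fun y ↦ pullbackBilin (fderiv ℝ F y) (G (F y))) (h ∘ F) z := by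
  have : FiniteDimensional ℝ W := e.finiteDimensional_of_finite
  have hdh : DifferentiableAt ℝ (fderiv ℝ h) (F z) :=
    (hh.fderiv_right (m := 1) (by norm_num)).differentiableAt (by simp)
  have hdF : DifferentiableAt ℝ (fderiv ℝ F) z :=
    (hF.fderiv_right (m := 1) (by norm_num)).differentiableAt (by simp)
  have hFd : DifferentiableAt ℝ F z := hF.differentiableAt (by simp)
  have hcalF := hF.continuousAt.eventually hcal
  set GM : W → W →L[ℝ] W →L[ℝ] ℝ := fun y ↦ pullbackBilin (fderiv ℝ F y) (G (F y)) with hGMdef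
  set θ : W → W [⋀^Fin (k + 1)]→L[ℝ] ℝ :=
    fun y ↦ (η (F y)).compContinuousLinearMap (fderiv ℝ F y) with hθdef
  have hGF : DifferentiableAt ℝ (fun y ↦ G (F y)) z :=
    DifferentiableAt.comp (G := V →L[ℝ] V →L[ℝ] ℝ) z hG hFd
  have hηF : DifferentiableAt ℝ (fun y ↦ η (F y)) z := hη.comp z hFd
  have hGM : DifferentiableAt ℝ GM z := hdF.pullbackBilin hGF
  have hθ : DifferentiableAt ℝ θ z :=
    hηF.continuousAlternatingMapCompContinuousLinearMap hdF
  have hcalM : ∀ᶠ y in 𝓝 z, IsCalibrating (GM y) (θ y) := by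
    filter_upwards [hcalF, hFinj] with y hy hi using hy.pullback hi
  have hu : ContDiffAt ℝ 2 (h ∘ F) z := hh.comp z hF
  have hdu : DifferentiableAt ℝ (fderiv ℝ (h ∘ F)) z :=
    (hu.fderiv_right (m := 1) (by norm_num)).differentiableAt (by simp)
  have hY := differentiableAt_inverse_apply hGM hdu hcalM.self_of_nhds.pos
  have hN := differentiableAt_inverse_apply hG hdh hcal.self_of_nhds.pos
  have hdhF : ∀ᶠ y in 𝓝 z, fderiv ℝ (h ∘ F) y = (fderiv ℝ h (F y)).comp (fderiv ℝ F y) := by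
    filter_upwards [hF.continuousAt.eventually (hh.eventually (by simp)), hF.eventually (by simp)]
      with y h1 h2
    exact fderiv_comp y (h1.differentiableAt (by simp)) (h2.differentiableAt (by simp))
  have hpull : (fun y ↦ (contract ((G (F y)).inverse (fderiv ℝ h (F y)))
      (η (F y))).compContinuousLinearMap (fderiv ℝ F y))
      =ᶠ[𝓝 z] fun y ↦ contract ((GM y).inverse (fderiv ℝ (h ∘ F) y)) (θ y) := by
    filter_upwards [hcalF, hFinj, hsub, hdhF] with y h1 h2 ⟨e', he'⟩ h3
    rw [h3]
    exact h1.contract_gradient h2 e' he' _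
  have hd := extDeriv_pullback (f := F) (x := z)
    (differentiableAt_contract hN hη) hF (by simp)
  have h1 : extDeriv (fun y ↦ contract ((G y).inverse (fderiv ℝ h y)) (η y)) (F z)
      (fun i ↦ fderiv ℝ F z (e i))
      = extDeriv (fun y ↦ contract ((GM y).inverse (fderiv ℝ (h ∘ F) y)) (θ y)) z e := by
    rw [← hpull.extDeriv_eq, hd]
    rfl
  have hθe : θ z e = 1 := he.2
  -- The volume form of `GM` agrees with `θ` to first order: its logarithmic derivative is the
  -- second sum in `coordLaplacian_eq`.
  have hvol := two_mul_fderiv_apply_eq_sum hcalM hGM hθ (fun i ↦ differentiableAt_const (e i)) he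
    ((GM z).inverse (fderiv ℝ (h ∘ F) z))
  simp only [fderiv_const_apply, zero_apply, map_zero, mul_zero, add_zero] at hvol
  rw [coordCovDeriv_eq_zero hcal hG hη he, sub_zero, h1, extDeriv_contract_apply hY hθ,
    coordLaplacian_eq hGM (hcalM.mono fun _ h ↦ h.symm) (hcalM.mono fun _ h ↦ h.pos) hu e
      he.1, hθe, Finset.sum_add_distrib, ← Finset.mul_sum]
  linarith

end

/-! ### Transport to charts -/

section

variable {V : Type*} [NormedAddCommGroup V] [NormedSpace ℝ V]
  {Y : Type*} [TopologicalSpace Y] [ChartedSpace V Y] {k : ℕ}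

/-- The derivative at `y` of the preferred chart at `y₀`. -/
noncomputable def chartDerivAt (y₀ y : Y) : TangentSpace 𝓘(ℝ, V) y →L[ℝ] V :=
  mfderiv 𝓘(ℝ, V) 𝓘(ℝ, V) (extChartAt 𝓘(ℝ, V) y₀) y

variable [IsManifold 𝓘(ℝ, V) ∞ Y]

theorem isInvertible_chartDerivAt {y₀ y : Y} (hy : y ∈ (extChartAt 𝓘(ℝ, V) y₀).source) :
    (chartDerivAt (V := V) y₀ y).IsInvertible := by
  have : IsManifold 𝓘(ℝ, V) 1 Y := .of_le (n := ∞) (by simp)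
  exact isInvertible_mfderiv_extChartAt hy

theorem surjective_chartDerivAt {y₀ y : Y} (hy : y ∈ (extChartAt 𝓘(ℝ, V) y₀).source) :
    Function.Surjective (chartDerivAt (V := V) y₀ y) :=
  (isInvertible_chartDerivAt hy).bijective.surjective

theorem chartFrame_chartDerivAt {y₀ : Y} {z : V} (hz : z ∈ (extChartAt 𝓘(ℝ, V) y₀).target)
    (v : TangentSpace 𝓘(ℝ, V) ((extChartAt 𝓘(ℝ, V) y₀).symm z)) :
    chartFrame y₀ z (chartDerivAt y₀ _ v) = v := by
  have : IsManifold 𝓘(ℝ, V) 1 Y := .of_le (n := ∞) (by simp)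
  have h := mfderivWithin_extChartAt_symm_comp_mfderiv_extChartAt (I := 𝓘(ℝ, V)) hz
  simp only [ModelWithCorners.range_eq_univ, mfderivWithin_univ] at h
  exact congrArg (fun l ↦ l v) h

theorem metricInChart_chartDerivAt (g : BilinField V Y) {y₀ y : Y}
    (hy : y ∈ (extChartAt 𝓘(ℝ, V) y₀).source) (v w : TangentSpace 𝓘(ℝ, V) y) :
    metricInChart g y₀ (extChartAt 𝓘(ℝ, V) y₀ y) (chartDerivAt y₀ y v) (chartDerivAt y₀ y w)
      = g y v w := by
  obtain ⟨z, hz, rfl⟩ : ∃ z ∈ (extChartAt 𝓘(ℝ, V) y₀).target, (extChartAt 𝓘(ℝ, V) y₀).symm z = y :=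
    ⟨_, (extChartAt 𝓘(ℝ, V) y₀).map_source hy, (extChartAt 𝓘(ℝ, V) y₀).left_inv hy⟩
  rw [(extChartAt 𝓘(ℝ, V) y₀).right_inv hz, metricInChart_apply, chartFrame_chartDerivAt hz,
    chartFrame_chartDerivAt hz]

theorem formInChart_chartDerivAt (η : FormField V Y k) {y₀ y : Y}
    (hy : y ∈ (extChartAt 𝓘(ℝ, V) y₀).source) (w : Fin k → TangentSpace 𝓘(ℝ, V) y) :
    formInChart η y₀ (extChartAt 𝓘(ℝ, V) y₀ y) (fun i ↦ chartDerivAt y₀ y (w i)) = η y w := by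
  obtain ⟨z, hz, rfl⟩ : ∃ z ∈ (extChartAt 𝓘(ℝ, V) y₀).target, (extChartAt 𝓘(ℝ, V) y₀).symm z = y :=
    ⟨_, (extChartAt 𝓘(ℝ, V) y₀).map_source hy, (extChartAt 𝓘(ℝ, V) y₀).left_inv hy⟩
  rw [(extChartAt 𝓘(ℝ, V) y₀).right_inv hz]
  change η _ (fun i ↦ chartFrame y₀ z (chartDerivAt y₀ _ (w i))) = _
  simp_rw [chartFrame_chartDerivAt hz]

theorem isCalibratedFrame_of_isPhiPlane {g : BilinField V Y} {η : FormField V Y k} {y₀ y : Y}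
    (hy : y ∈ (extChartAt 𝓘(ℝ, V) y₀).source) {ξ : Fin k → TangentSpace 𝓘(ℝ, V) y}
    (hξ : IsPhiPlane g η y ξ) :
    IsCalibratedFrame (metricInChart g y₀ (extChartAt 𝓘(ℝ, V) y₀ y))
      (formInChart η y₀ (extChartAt 𝓘(ℝ, V) y₀ y)) (fun i ↦ chartDerivAt y₀ y (ξ i)) := by
  refine ⟨fun i j ↦ ?_, ?_⟩
  · rw [metricInChart_chartDerivAt g hy, hξ.1 i j]
  · rw [formInChart_chartDerivAt η hy, hξ.2]

theorem isCalibrating_of_isCalibration {g : BilinField V Y} (hsymm : ∀ y v w, g y v w = g y w v)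
    (hpos : ∀ y v, v ≠ 0 → 0 < g y v v) {η : FormField V Y k} (hη : IsCalibration g η) {y₀ : Y}
    {z : V} (hz : z ∈ (extChartAt 𝓘(ℝ, V) y₀).target) :
    IsCalibrating (metricInChart g y₀ z) (formInChart η y₀ z) := by
  refine ⟨fun v w ↦ ?_, fun v hv ↦ ?_, fun ξ hξ ↦ ?_⟩
  · rw [metricInChart_apply, metricInChart_apply, hsymm]
  · obtain ⟨v', rfl⟩ := surjective_chartDerivAt ((extChartAt 𝓘(ℝ, V) y₀).map_target hz) v
    rw [metricInChart_apply, chartFrame_chartDerivAt hz]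
    exact hpos _ _ fun h ↦ hv (by rw [h, map_zero])
  · exact hη.comass_le_one _ (fun i ↦ chartFrame y₀ z (ξ i)) hξ

theorem fderiv_comp_extChartAt_symm {E : Type*} [NormedAddCommGroup E] [NormedSpace ℝ E]
    {f : Y → E} {y₀ y : Y} (hy : y ∈ (extChartAt 𝓘(ℝ, V) y₀).source)
    (hf : MDifferentiableAt 𝓘(ℝ, V) 𝓘(ℝ, E) f y) (v : TangentSpace 𝓘(ℝ, V) y) :
    fderiv ℝ (f ∘ (extChartAt 𝓘(ℝ, V) y₀).symm) (extChartAt 𝓘(ℝ, V) y₀ y) (chartDerivAt y₀ y v)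
      = mfderiv 𝓘(ℝ, V) 𝓘(ℝ, E) f y v := by
  have : IsManifold 𝓘(ℝ, V) 1 Y := .of_le (n := ∞) (by simp)
  have hy' : y ∈ (chartAt V y₀).source := by rwa [extChartAt_source] at hy
  have hd : MDifferentiableAt 𝓘(ℝ, V) 𝓘(ℝ, E) (f ∘ (extChartAt 𝓘(ℝ, V) y₀).symm)
      (extChartAt 𝓘(ℝ, V) y₀ y) := by
    have h1 := mdifferentiableWithinAt_extChartAt_symm (I := 𝓘(ℝ, V))
      ((extChartAt 𝓘(ℝ, V) y₀).map_source hy)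
    rw [ModelWithCorners.range_eq_univ, mdifferentiableWithinAt_univ] at h1
    refine MDifferentiableAt.comp _ ?_ h1
    rwa [(extChartAt 𝓘(ℝ, V) y₀).left_inv hy]
  have h1 := mfderiv_comp y hd (mdifferentiableAt_extChartAt (I := 𝓘(ℝ, V)) hy')
  have h2 : (f ∘ (extChartAt 𝓘(ℝ, V) y₀).symm) ∘ extChartAt 𝓘(ℝ, V) y₀ =ᶠ[𝓝 y] f := by
    filter_upwards [extChartAt_source_mem_nhds' hy] with p hp
    exact congrArg f ((extChartAt 𝓘(ℝ, V) y₀).left_inv hp)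
  rw [h2.mfderiv_eq, mfderiv_eq_fderiv] at h1
  exact (congrArg (fun l : V →L[ℝ] E ↦ l v) h1).symm

theorem chartDerivAt_riemGradient {g : BilinField V Y} {y₀ y : Y}
    (hy : y ∈ (extChartAt 𝓘(ℝ, V) y₀).source) (hg : (g y).IsInvertible)
    (hg' : (metricInChart g y₀ (extChartAt 𝓘(ℝ, V) y₀ y)).IsInvertible) {f : Y → ℝ}
    (hf : MDifferentiableAt 𝓘(ℝ, V) 𝓘(ℝ, ℝ) f y) :
    chartDerivAt y₀ y (riemGradient g f y)
      = (metricInChart g y₀ (extChartAt 𝓘(ℝ, V) y₀ y)).inverse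
        (fderiv ℝ (f ∘ (extChartAt 𝓘(ℝ, V) y₀).symm) (extChartAt 𝓘(ℝ, V) y₀ y)) := by
  refine (hg'.inverse_apply_eq.2 ?_).symm
  ext w
  obtain ⟨w, rfl⟩ := surjective_chartDerivAt hy w
  rw [metricInChart_chartDerivAt g hy, fderiv_comp_extChartAt_symm hy hf]
  exact congrArg (fun l : TangentSpace 𝓘(ℝ, V) y →L[ℝ] ℝ ↦ l w) (hg.self_apply_inverse _).symm

theorem formInChart_dPhi {g : BilinField V Y} {y₀ y : Y}
    (hy : y ∈ (extChartAt 𝓘(ℝ, V) y₀).source) (hg : (g y).IsInvertible)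
    (hg' : (metricInChart g y₀ (extChartAt 𝓘(ℝ, V) y₀ y)).IsInvertible) {f : Y → ℝ}
    (hf : MDifferentiableAt 𝓘(ℝ, V) 𝓘(ℝ, ℝ) f y) (η : FormField V Y (k + 1)) :
    formInChart (dPhi g η f) y₀ (extChartAt 𝓘(ℝ, V) y₀ y)
      = contract ((metricInChart g y₀ (extChartAt 𝓘(ℝ, V) y₀ y)).inverse
        (fderiv ℝ (f ∘ (extChartAt 𝓘(ℝ, V) y₀).symm) (extChartAt 𝓘(ℝ, V) y₀ y)))
        (formInChart η y₀ (extChartAt 𝓘(ℝ, V) y₀ y)) := by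
  ext w
  choose w' hw' using fun i ↦ surjective_chartDerivAt hy (w i)
  obtain rfl : (fun i ↦ chartDerivAt y₀ y (w' i)) = w := funext hw'
  rw [formInChart_chartDerivAt _ hy, ← chartDerivAt_riemGradient hy hg hg' hf, contract_apply]
  have : Matrix.vecCons (chartDerivAt y₀ y (riemGradient g f y)) (fun i ↦ chartDerivAt y₀ y (w' i))
      = fun i ↦ chartDerivAt y₀ y (Matrix.vecCons (riemGradient g f y) w' i) := by
    ext i
    refine Fin.cases ?_ (fun i ↦ ?_) i <;> simp
  rw [this, formInChart_chartDerivAt _ hy]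
  rfl

end

section

variable {V : Type*} [NormedAddCommGroup V] [NormedSpace ℝ V] [FiniteDimensional ℝ V]
  {Y : Type*} [TopologicalSpace Y] [ChartedSpace V Y] [IsManifold 𝓘(ℝ, V) ∞ Y]

/-- Coefficient by coefficient: the chart frame is the local frame of the tangent bundle given by
the trivialization at `y₀`, hence smooth. -/
theorem contDiffOn_metricInChart (g : Bundle.ContMDiffRiemannianMetric 𝓘(ℝ, V) ∞ V
      (fun y : Y ↦ TangentSpace 𝓘(ℝ, V) y)) (y₀ : Y) :
    ContDiffOn ℝ ∞ (metricInChart g.inner y₀) (extChartAt 𝓘(ℝ, V) y₀).target := by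
  have : IsManifold 𝓘(ℝ, V) 1 Y := .of_le (n := ∞) (by simp)
  rw [contDiffOn_clm_apply]
  intro v
  rw [contDiffOn_clm_apply]
  intro w
  set e := trivializationAt V (TangentSpace 𝓘(ℝ, V)) y₀
  have hsec : ∀ v : V, ContMDiffOn 𝓘(ℝ, V) (𝓘(ℝ, V).prod 𝓘(ℝ, V)) ∞
      (fun y ↦ Bundle.TotalSpace.mk' V (E := (TangentSpace 𝓘(ℝ, V) : Y → Type _)) y (e.symmL ℝ y v))
      e.baseSet := by
    intro v
    refine (e.contMDiffOn_section_baseSet_iff (𝕜 := ℝ) (IB := 𝓘(ℝ, V)) (n := ∞)).2 ?_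
    refine (contMDiffOn_const (c := v)).congr fun y hy ↦ ?_
    have h := e.continuousLinearMapAt_symmL (R := ℝ) hy v
    rwa [e.continuousLinearMapAt_apply ℝ, e.coe_linearMapAt_of_mem hy] at h
  have h1 : ContMDiffOn 𝓘(ℝ, V) 𝓘(ℝ, ℝ) ∞
      (fun y ↦ g.inner y (e.symmL ℝ y v) (e.symmL ℝ y w)) e.baseSet := by
    have h : ContMDiffOn 𝓘(ℝ, V) (𝓘(ℝ, V).prod 𝓘(ℝ, ℝ)) ∞
      (fun y ↦ Bundle.TotalSpace.mk' ℝ (E := Bundle.Trivial Y ℝ) y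
        (g.inner y (e.symmL ℝ y v) (e.symmL ℝ y w))) e.baseSet :=
      ContMDiffOn.clm_bundle_apply₂ (F₁ := V) (F₂ := V) g.contMDiff.contMDiffOn (hsec v) (hsec w)
    intro y hy
    have := h y hy
    simp only [Bundle.contMDiffWithinAt_totalSpace] at this
    exact this.2
  have h2 := h1.comp (contMDiffOn_extChartAt_symm (I := 𝓘(ℝ, V)) (n := ∞) y₀) (fun z hz ↦ by
    have := (extChartAt 𝓘(ℝ, V) y₀).map_target hz
    rwa [extChartAt_source] at this)
  rw [contMDiffOn_iff_contDiffOn] at h2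
  refine h2.congr fun z hz ↦ ?_
  have hy : (extChartAt 𝓘(ℝ, V) y₀).symm z ∈ (chartAt V y₀).source := by
    have := (extChartAt 𝓘(ℝ, V) y₀).map_target hz
    rwa [extChartAt_source] at this
  have hs : ∀ v : V, e.symmL ℝ ((extChartAt 𝓘(ℝ, V) y₀).symm z) v = chartFrame y₀ z v := by
    intro v
    have := TangentBundle.symmL_trivializationAt (I := 𝓘(ℝ, V)) (𝕜 := ℝ) hy
    simp only [ModelWithCorners.range_eq_univ, mfderivWithin_univ] at this
    rw [(extChartAt 𝓘(ℝ, V) y₀).right_inv hz] at this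
    exact congrArg (fun l ↦ l v) this
  rw [metricInChart_apply, Function.comp_apply, hs, hs]

end

/-! ### Submanifolds in charts -/

section

variable {V W : Type*} [NormedAddCommGroup V] [NormedSpace ℝ V] [NormedAddCommGroup W]
  [NormedSpace ℝ W] {X : Type*} [TopologicalSpace X] [ChartedSpace V X] {k : ℕ}

/-- The inclusion of the submanifold `M` in `X`, in the preferred charts at `m`. -/
noncomputable def inclInChart (V : Type*) {W : Type*} [NormedAddCommGroup V] [NormedSpace ℝ V]
    [NormedAddCommGroup W] [NormedSpace ℝ W] {X : Type*} [TopologicalSpace X] [ChartedSpace V X]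
    {M : Set X} [ChartedSpace W M] (m : M) : W → V :=
  (extChartAt 𝓘(ℝ, V) (m : X) ∘ Subtype.val) ∘ (extChartAt 𝓘(ℝ, W) m).symm

theorem inclInChart_extChartAt {M : Set X} [ChartedSpace W M] {m m' : M}
    (hm' : m' ∈ (extChartAt 𝓘(ℝ, W) m).source) :
    inclInChart V m (extChartAt 𝓘(ℝ, W) m m') = extChartAt 𝓘(ℝ, V) (m : X) m' := by
  simp only [inclInChart, Function.comp_apply, (extChartAt 𝓘(ℝ, W) m).left_inv hm']

theorem contDiffAt_inclInChart {M : Set X} [ChartedSpace W M] (hM : IsSubmanifold V W M) (m : M) :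
    ContDiffAt ℝ ∞ (inclInChart V m) (extChartAt 𝓘(ℝ, W) m m) := by
  have := (contMDiffAt_iff.1 (hM.contMDiff m)).2
  rw [ModelWithCorners.range_eq_univ, contDiffWithinAt_univ] at this
  exact this

variable [IsManifold 𝓘(ℝ, V) ∞ X]

theorem fderiv_inclInChart {M : Set X} [ChartedSpace W M] (hM : IsSubmanifold V W M) {m m' : M}
    (hm' : m' ∈ (extChartAt 𝓘(ℝ, W) m).source)
    (hx : (m' : X) ∈ (extChartAt 𝓘(ℝ, V) (m : X)).source) (v : TangentSpace 𝓘(ℝ, W) m') :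
    fderiv ℝ (inclInChart V m) (extChartAt 𝓘(ℝ, W) m m') (chartDerivAt m m' v)
      = chartDerivAt (m : X) (m' : X) (inclDeriv V W M m' v) := by
  have := hM.isManifold
  have : IsManifold 𝓘(ℝ, V) 1 X := .of_le (n := ∞) (by simp)
  have hx' : (m' : X) ∈ (chartAt V (m : X)).source := by rwa [extChartAt_source] at hx
  have h1 := mdifferentiableAt_extChartAt (I := 𝓘(ℝ, V)) hx'
  have h2 := hM.contMDiff.mdifferentiableAt (x := m') (by simp)
  have h3 := mfderiv_comp m' h1 h2
  rw [inclInChart, fderiv_comp_extChartAt_symm hm' (h1.comp m' h2)]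
  exact congrArg (fun l : TangentSpace 𝓘(ℝ, W) m' →L[ℝ] V ↦ l v) h3

theorem injective_fderiv_inclInChart {M : Set X} [ChartedSpace W M] (hM : IsSubmanifold V W M)
    {m m' : M} (hm' : m' ∈ (extChartAt 𝓘(ℝ, W) m).source)
    (hx : (m' : X) ∈ (extChartAt 𝓘(ℝ, V) (m : X)).source) :
    Function.Injective (fderiv ℝ (inclInChart V m) (extChartAt 𝓘(ℝ, W) m m')) := by
  have := hM.isManifold
  intro v w hvw
  obtain ⟨v, rfl⟩ := surjective_chartDerivAt hm' v
  obtain ⟨w, rfl⟩ := surjective_chartDerivAt hm' w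
  rw [fderiv_inclInChart hM hm' hx, fderiv_inclInChart hM hm' hx] at hvw
  rw [hM.injective m' ((isInvertible_chartDerivAt hx).bijective.injective hvw)]

theorem metricInChart_inducedMetric (g : BilinField V X) {M : Set X} [ChartedSpace W M]
    (hM : IsSubmanifold V W M) {m m' : M} (hm' : m' ∈ (extChartAt 𝓘(ℝ, W) m).source)
    (hx : (m' : X) ∈ (extChartAt 𝓘(ℝ, V) (m : X)).source) :
    metricInChart (inducedMetric g M) m (extChartAt 𝓘(ℝ, W) m m')
      = pullbackBilin (fderiv ℝ (inclInChart V m) (extChartAt 𝓘(ℝ, W) m m'))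
        (metricInChart g (m : X) (inclInChart V m (extChartAt 𝓘(ℝ, W) m m'))) := by
  have := hM.isManifold
  ext v w
  obtain ⟨v, rfl⟩ := surjective_chartDerivAt hm' v
  obtain ⟨w, rfl⟩ := surjective_chartDerivAt hm' w
  rw [metricInChart_chartDerivAt _ hm', pullbackBilin_apply, fderiv_inclInChart hM hm' hx,
    fderiv_inclInChart hM hm' hx, inclInChart_extChartAt hm', metricInChart_chartDerivAt _ hx,
    inducedMetric_apply]

/-- In a chart, a positively oriented basis of the tangent space of a submanifold becomes a basis
of the model space that is mapped to a calibrated frame. -/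
theorem exists_basis_isCalibratedFrame {g : BilinField V X} {φ : FormField V X k} {M : Set X}
    [ChartedSpace W M] (hM : IsSubmanifold V W M)
    {o : ∀ m : M, Orientation ℝ (TangentSpace 𝓘(ℝ, W) m) (Fin k)} {m m' : M}
    (hm' : m' ∈ (extChartAt 𝓘(ℝ, W) m).source)
    (hx : (m' : X) ∈ (extChartAt 𝓘(ℝ, V) (m : X)).source)
    {ξ : Fin k → TangentSpace 𝓘(ℝ, V) (m' : X)} (hξ : IsOrientedTangent M o m' ξ)
    (hφ : IsPhiPlane g φ m' ξ) :
    ∃ e : Module.Basis (Fin k) ℝ W,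
      (∀ i, fderiv ℝ (inclInChart V m) (extChartAt 𝓘(ℝ, W) m m') (e i)
        = chartDerivAt (m : X) (m' : X) (ξ i)) ∧
      IsCalibratedFrame (metricInChart g (m : X) (inclInChart V m (extChartAt 𝓘(ℝ, W) m m')))
        (formInChart φ (m : X) (inclInChart V m (extChartAt 𝓘(ℝ, W) m m')))
        (fun i ↦ fderiv ℝ (inclInChart V m) (extChartAt 𝓘(ℝ, W) m m') (e i)) := by
  have := hM.isManifold
  obtain ⟨e, -, he⟩ := hξ
  obtain ⟨D, hD⟩ := isInvertible_chartDerivAt (V := W) hm'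
  have h1 : ∀ i, fderiv ℝ (inclInChart V m) (extChartAt 𝓘(ℝ, W) m m') (e.map D.toLinearEquiv i)
      = chartDerivAt (m : X) (m' : X) (ξ i) := by
    intro i
    rw [← he, ← fderiv_inclInChart hM hm' hx, ← hD]
    rfl
  refine ⟨e.map D.toLinearEquiv, h1, ?_⟩
  simp_rw [h1, inclInChart_extChartAt hm']
  exact isCalibratedFrame_of_isPhiPlane hx hφ

end

/-! ### The pointwise identity on a calibrated submanifold -/

theorem Filter.EventuallyEq.coordLaplacian_eq {W : Type*} [NormedAddCommGroup W] [NormedSpace ℝ W]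
    {G G' : W → W →L[ℝ] W →L[ℝ] ℝ} {u u' : W → ℝ} {z : W} (hG : G =ᶠ[𝓝 z] G')
    (hu : u =ᶠ[𝓝 z] u') : coordLaplacian G u z = coordLaplacian G' u' z := by
  simp only [coordLaplacian, coordHessianEnd, coordHessian, christoffel, hG.eq_of_nhds,
    hG.fderiv_eq, hu.fderiv_eq, hu.fderiv.fderiv_eq]

section

variable {V W : Type*} [NormedAddCommGroup V] [NormedSpace ℝ V] [NormedAddCommGroup W]
  [NormedSpace ℝ W] {X : Type*} [TopologicalSpace X] [ChartedSpace V X] {k : ℕ}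

theorem eventually_exists_extChartAt_eq (M : Set X) [ChartedSpace W M] (m : M) :
    ∀ᶠ y in 𝓝 (extChartAt 𝓘(ℝ, W) m m), ∃ m' ∈ (extChartAt 𝓘(ℝ, W) m).source,
      (m' : X) ∈ (extChartAt 𝓘(ℝ, V) (m : X)).source ∧ extChartAt 𝓘(ℝ, W) m m' = y := by
  have hc : ContinuousAt (fun y ↦ ((extChartAt 𝓘(ℝ, W) m).symm y : X))
      (extChartAt 𝓘(ℝ, W) m m) :=
    continuous_subtype_val.continuousAt.comp (continuousAt_extChartAt_symm m)
  have hx : (extChartAt 𝓘(ℝ, V) (m : X)).source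
      ∈ 𝓝 ((extChartAt 𝓘(ℝ, W) m).symm (extChartAt 𝓘(ℝ, W) m m) : X) := by
    rw [extChartAt_to_inv]
    exact extChartAt_source_mem_nhds (I := 𝓘(ℝ, V)) (m : X)
  filter_upwards [extChartAt_target_mem_nhds (I := 𝓘(ℝ, W)) m, hc hx] with y hy hx
  exact ⟨_, (extChartAt 𝓘(ℝ, W) m).map_target hy, hx, (extChartAt 𝓘(ℝ, W) m).right_inv hy⟩

/-- On a `φ`-submanifold `M`, the `φ`-Hessian `d d^φ f - ∇_{∇f} φ` of `f`, evaluated on the tangent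
planes of `M`, is the Laplacian of the restriction of `f` to `M`. -/
theorem extDerivForm_dPhi_sub_covDerivForm_eq_laplaceBeltrami [FiniteDimensional ℝ V]
    [IsManifold 𝓘(ℝ, V) ∞ X]
    (g : Bundle.ContMDiffRiemannianMetric 𝓘(ℝ, V) ∞ V (fun x : X ↦ TangentSpace 𝓘(ℝ, V) x))
    {φ : FormField V X (k + 1)} (hφ : IsCalibration g.inner φ) {f : X → ℝ}
    (hf : ContMDiff 𝓘(ℝ, V) 𝓘(ℝ, ℝ) ∞ f) {M : Set X} [ChartedSpace W M]
    {o : ∀ m : M, Orientation ℝ (TangentSpace 𝓘(ℝ, W) m) (Fin (k + 1))}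
    (hM : IsPhiSubmanifold g.inner φ M o) {m : M}
    {ξ : Fin (k + 1) → TangentSpace 𝓘(ℝ, V) (m : X)} (hξ : IsOrientedTangent M o m ξ)
    (hξφ : IsPhiPlane g.inner φ m ξ) :
    extDerivForm (dPhi g.inner φ f) (m : X) ξ
        - covDerivForm g.inner φ (m : X) (riemGradient g.inner f m) ξ
      = laplaceBeltrami (V := W) (inducedMetric g.inner M) (fun m : M ↦ f m) m := by
  have hS := hM.toIsSubmanifold
  have hsm := mem_extChartAt_source (I := 𝓘(ℝ, W)) m
  have hsx := mem_extChartAt_source (I := 𝓘(ℝ, V)) (m : X)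
  set z := extChartAt 𝓘(ℝ, W) m m with hz
  set F : W → V := inclInChart V m with hFdef
  set h : V → ℝ := f ∘ (extChartAt 𝓘(ℝ, V) (m : X)).symm with hh
  have hFz : F z = extChartAt 𝓘(ℝ, V) (m : X) m := inclInChart_extChartAt hsm
  have htarget : (extChartAt 𝓘(ℝ, V) (m : X)).target ∈ 𝓝 (F z) := by
    rw [hFz]
    exact extChartAt_target_mem_nhds (m : X)
  have hginv : ∀ x : X, (g.inner x).IsInvertible := fun x ↦
    isInvertible_of_pos (V := V) (B := g.inner x) (g.pos x)
  have hcal : ∀ᶠ y in 𝓝 (F z),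
      IsCalibrating (metricInChart g.inner (m : X) y) (formInChart φ (m : X) y) := by
    filter_upwards [htarget] with y hy using isCalibrating_of_isCalibration g.symm g.pos hφ hy
  have hG : DifferentiableAt ℝ (metricInChart g.inner (m : X)) (F z) :=
    ((contDiffOn_metricInChart g m).contDiffAt htarget).differentiableAt (by simp)
  have hη : DifferentiableAt ℝ (formInChart φ (m : X)) (F z) :=
    ((hφ.smooth m).contDiffAt htarget).differentiableAt (by simp)
  have hhd : ContDiffAt ℝ 2 h (F z) := by
    have := (contMDiffAt_iff.1 (hf m)).2
    rw [ModelWithCorners.range_eq_univ, contDiffWithinAt_univ] at this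
    rw [hFz]
    exact ContDiffAt.of_le this ENat.LEInfty.out
  have hFd : ContDiffAt ℝ 2 F z := (contDiffAt_inclInChart hS m).of_le ENat.LEInfty.out
  have hnear := eventually_exists_extChartAt_eq (V := V) (W := W) M m
  obtain ⟨e, he, heφ⟩ := exists_basis_isCalibratedFrame hS hsm hsx hξ hξφ
  have key := extDeriv_sub_coordCovDeriv_eq_coordLaplacian hcal hG hη hhd hFd
    (by
      filter_upwards [hnear] with _ ⟨m', h1, h2, h3⟩
      rw [← h3]
      exact injective_fderiv_inclInChart hS h1 h2)
    (by
      filter_upwards [hnear] with _ ⟨m', h1, h2, h3⟩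
      obtain ⟨ξ', hξ', hξφ'⟩ := hM.calibrated m'
      obtain ⟨e', -, he'⟩ := exists_basis_isCalibratedFrame hS h1 h2 hξ' hξφ'
      rw [← h3]
      exact ⟨e', he'⟩) e heφ
  have hmet : metricInChart (inducedMetric g.inner M) m =ᶠ[𝓝 z]
      fun y ↦ pullbackBilin (fderiv ℝ F y) (metricInChart g.inner (m : X) (F y)) := by
    filter_upwards [hnear] with _ ⟨m', h1, h2, h3⟩
    rw [← h3]
    exact metricInChart_inducedMetric g.inner hS h1 h2
  have hfun : (fun m : M ↦ f m) ∘ (extChartAt 𝓘(ℝ, W) m).symm =ᶠ[𝓝 z] h ∘ F := by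
    filter_upwards [hnear] with _ ⟨m', h1, h2, h3⟩
    rw [← h3, Function.comp_apply, Function.comp_apply, (extChartAt 𝓘(ℝ, W) m).left_inv h1,
      hFdef, inclInChart_extChartAt h1, hh, Function.comp_apply,
      (extChartAt 𝓘(ℝ, V) (m : X)).left_inv h2]
  have hform : formInChart (dPhi g.inner φ f) (m : X) =ᶠ[𝓝 (F z)]
      fun y ↦ contract ((metricInChart g.inner (m : X) y).inverse (fderiv ℝ h y))
        (formInChart φ (m : X) y) := by
    filter_upwards [htarget, hcal] with y hy hyc
    have h1 := (extChartAt 𝓘(ℝ, V) (m : X)).map_target hy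
    have h2 := (extChartAt 𝓘(ℝ, V) (m : X)).right_inv hy
    have h3 := formInChart_dPhi (y₀ := (m : X)) h1 (hginv _)
      (by rw [h2]; exact isInvertible_of_pos hyc.pos) (hf.mdifferentiableAt (by simp)) φ
    rwa [h2] at h3
  have he' : (fun i ↦ fderiv ℝ F z (e i)) = fun i ↦ chartDerivAt (m : X) (m : X) (ξ i) := funext he
  rw [laplaceBeltrami, hmet.coordLaplacian_eq hfun, ← key, he', ← hform.extDeriv_eq]
  have hgrad := chartDerivAt_riemGradient (y₀ := (m : X)) hsx (hginv m)
    (by rw [← hFz]; exact isInvertible_of_pos hcal.self_of_nhds.pos)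
    (hf.mdifferentiableAt (x := (m : X)) (by simp))
  rw [hFz, ← hgrad]
  rfl

end

theorem theorem1p4 {n p : ℕ}
    {X : Type*} [TopologicalSpace X] [ChartedSpace (EuclideanSpace ℝ (Fin n)) X]
    [IsManifold 𝓘(ℝ, EuclideanSpace ℝ (Fin n)) ∞ X]
    (g : Bundle.ContMDiffRiemannianMetric 𝓘(ℝ, EuclideanSpace ℝ (Fin n)) ∞ (EuclideanSpace ℝ (Fin n))
      (fun x : X ↦ TangentSpace 𝓘(ℝ, EuclideanSpace ℝ (Fin n)) x))
    (φ : FormField (EuclideanSpace ℝ (Fin n)) X (p + 1))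
    (hφ : IsCalibration g.inner φ)
    (f : X → ℝ) (hf : ContMDiff 𝓘(ℝ, EuclideanSpace ℝ (Fin n)) 𝓘(ℝ, ℝ) ∞ f) :
    (IsPhiPlurisubharmonic g.inner φ f →
      ∀ (M : Set X) [ChartedSpace (EuclideanSpace ℝ (Fin (p + 1))) M]
        (o : ∀ m : M,
          Orientation ℝ (TangentSpace 𝓘(ℝ, EuclideanSpace ℝ (Fin (p + 1))) m) (Fin (p + 1))),
        IsPhiSubmanifold g.inner φ M o →
          IsSubharmonic (V := EuclideanSpace ℝ (Fin (p + 1))) (inducedMetric g.inner M)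
            (fun m : M ↦ f m)) ∧
    (IsIntegrable g.inner φ →
      (∀ (M : Set X) [ChartedSpace (EuclideanSpace ℝ (Fin (p + 1))) M]
        (o : ∀ m : M,
          Orientation ℝ (TangentSpace 𝓘(ℝ, EuclideanSpace ℝ (Fin (p + 1))) m) (Fin (p + 1))),
        IsPhiSubmanifold g.inner φ M o →
          IsSubharmonic (V := EuclideanSpace ℝ (Fin (p + 1))) (inducedMetric g.inner M)
            (fun m : M ↦ f m)) →
      IsPhiPlurisubharmonic g.inner φ f) := by
  refine ⟨fun h M _ o hM m ↦ ?_, fun hint h x ξ hξ ↦ ?_⟩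
  · obtain ⟨ξ, hξ, hξφ⟩ := hM.calibrated m
    rw [← extDerivForm_dPhi_sub_covDerivForm_eq_laplaceBeltrami g hφ hf hM hξ hξφ]
    exact h m ξ hξφ
  · obtain ⟨M, _, o, hx, hM, hξM⟩ := hint x ξ hξ
    have := h M o hM ⟨x, hx⟩
    rwa [← extDerivForm_dPhi_sub_covDerivForm_eq_laplaceBeltrami g hφ hf hM hξM hξ] at this
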